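/- Let $d\in\mathbb N$, $\alpha>0$, and let $\sigma$ be a finite Borel measure on the Euclidean unit sphere $S=\{x\in\mathbb{R}^d:\|x\|=1\}$. Let $\xi_1,\xi_2,\dots$ be i.i.d. $\mathbb{R}^d$-valued random vectors, defined on one probability space, which are regularly varying with tail index $\alpha$, spectral measure $\sigma$ and normalization $b_n=n^{1/\alpha}$; that is, for every $\rho>0$ and every Borel set $B\subset S$ with $\sigma(\partial B)=0$ (boundary relative to $S$), \[ \lim_{n\to\infty} n\,\mathbf P\Big\{\frac{\xi_1}{\|\xi_1\|}\in B,\ \|\xi_1\|>\rho\, n^{1/\alpha}\Big\}=\sigma(B)\,\rho^{-\alpha}. \] Let $r\in(0,1)$ and, for every sample size $N\ge 1$, put $n=[N^r]$ and $m=[N/n]$, where $[\cdot]$ is the integer part. For every $N$, let $G_{m,1},\dots,G_{m,n}$ be pairwise disjoint groups of $m$ vectors each (disjoint as sets of indices), chosen in a non-random way from the sample $\xi_1,\dots,\xi_N$. Put \[ M^{(1)}_{m,i}=\max\{\|\xi\| : \xi\in G_{m,i}\},\qquad q_{m,i}=\frac{M^{(1)}_{m,i}}{m^{1/\alpha}},\qquad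 i=1,\dots,n . \] Then for every $t$ with $0<t<\alpha r/2$, \[ \widehat{\sigma(S)}_N:=\Big(\frac{1}{n\,\Gamma(1-t/\alpha)}\sum_{i=1}^n q_{m,i}^{\,t}\Big)^{\alpha/t}\ \longrightarrow\ \sigma(S)\qquad\text{almost surely as } N\to\infty . \] -/

import Mathlib

open MeasureTheory ProbabilityTheory Filter Topology

noncomputable section

/-- The unit sphere of `ℝ^d` for the Euclidean norm. -/
abbrev UnitSphere (d : ℕ) : Type :=
  Metric.sphere (0 : EuclideanSpace ℝ (Fin d)) 1

/-- Regular variation of the random vector `X` with tail index `α`, spectral measure `σ` and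
normalizing sequence `b`: for all `ρ > 0` and all Borel sets `B` of the unit sphere whose boundary
(relative to the sphere) is `σ`-null,
`n P(X / ‖X‖ ∈ B, ‖X‖ > ρ b_n) → σ(B) ρ ^ (-α)`. -/
def RegularVariationWith {d : ℕ} {Ω : Type*} [MeasurableSpace Ω] (P : Measure Ω)
    (X : Ω → EuclideanSpace ℝ (Fin d)) (α : ℝ) (σ : Measure (UnitSphere d))
    (b : ℕ → ℝ) : Prop :=
  ∀ ρ : ℝ, 0 < ρ → ∀ B : Set (UnitSphere d), MeasurableSet B → σ (frontier B) = 0 →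
    Tendsto
      (fun n : ℕ => (n : ℝ) *
        P.real {ω | ‖X ω‖⁻¹ • X ω ∈ (Subtype.val '' B : Set (EuclideanSpace ℝ (Fin d))) ∧
          ρ * b n < ‖X ω‖})
      atTop (𝓝 (σ.real B * ρ ^ (-α)))

/-- The number of groups, `n = [N ^ r]`. -/
def groupCount (r : ℝ) (N : ℕ) : ℕ := ⌊(N : ℝ) ^ r⌋₊

/-- The size of each group, `m = [N / n]` (the division of natural numbers takes the
integer part). -/
def groupSize (r : ℝ) (N : ℕ) : ℕ := N / groupCount r N

/-- `G 0, …, G (n - 1)` are `n` pairwise disjoint groups of indices, each with `m` elements, taken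
from a sample of size `N` whose members have the indices `0, …, N - 1`. -/
structure IsGrouping (N n m : ℕ) (G : ℕ → Finset ℕ) : Prop where
  subset_sample : ∀ i < n, G i ⊆ Finset.range N
  card_eq : ∀ i < n, (G i).card = m
  disjoint : ∀ i < n, ∀ j < n, i ≠ j → Disjoint (G i) (G j)

/-- The largest norm of the vectors `x j` with `j` in the group `A` (`0` for an empty group). -/
def maxNorm {d : ℕ} (x : ℕ → EuclideanSpace ℝ (Fin d)) (A : Finset ℕ) : ℝ :=
  ((A.sup fun j => ‖x j‖₊ : NNReal) : ℝ)

/-- The estimator `((1 / (n Γ(1 - t/α))) ∑ i, q_i ^ t) ^ (α / t)` of the total mass, where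
`q_i = M_i / m ^ (1/α)` and `M_i` is the largest norm in the `i`-th of the `n` groups of
size `m`. -/
def totalMassEstimator {d : ℕ} (α t : ℝ) (n m : ℕ) (G : ℕ → Finset ℕ)
    (x : ℕ → EuclideanSpace ℝ (Fin d)) : ℝ :=
  (1 / ((n : ℝ) * Real.Gamma (1 - t / α)) *
    ∑ i ∈ Finset.range n, (maxNorm x (G i) / (m : ℝ) ^ (1 / α)) ^ t) ^ (α / t)

end

/-! Put `a = α / t` and `s = σ(S)`. If `T` is the tail of `‖ξ 0‖`, then `q ^ t` has tail `1 - (1 -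
T(y ^ (1/t) m ^ (1/α))) ^ m`. Since `m T(ρ m ^ (1/α)) → s ρ ^ (-α)`, this tends to the Fréchet tail
`1 - exp(-s y ^ (-a))`, whose mean is `s ^ (1/a) Γ(1 - 1/a)` (`integral_one_sub_exp_neg_mul_rpow`).
The estimator inverts this relation, so it remains to show that the row averages converge almost
surely to that mean.

This is `ae_tendsto_average_of_tail`. The tails are uniformly `O(y ^ (-a))`, and `t < α r / 2` means
`a r > 2`. Truncating at a suitable power of `N`, the union bound makes the truncation harmless,
Bernstein's inequality controls the truncated sums, and dominated convergence gives the limit of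
their means. Both error probabilities are summable in `N`, so Borel–Cantelli applies whatever the
dependence between rows. -/

/-! ### The Fréchet mean and power bounds on tails. -/

/-- The mean of `(Z / s) ^ (-1 / a)` for a standard exponential `Z`, written as the integral of
its tail. -/
theorem integral_one_sub_exp_neg_mul_rpow {s a : ℝ} (hs : 0 ≤ s) (ha : 1 < a) :
    ∫ y in Set.Ioi (0 : ℝ), (1 - Real.exp (-(s * y ^ (-a)))) =
      s ^ (1 / a) * Real.Gamma (1 - 1 / a) := by
  have ha0 : 0 < a := by linarith
  rcases hs.eq_or_lt with rfl | hs
  · simp [Real.zero_rpow, ha0.ne']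
  have ha1 : 1 / a < 1 := by rw [div_lt_one ha0]; exact ha
  set g : ℝ → ENNReal := fun x => ENNReal.ofReal (Real.exp (-x))
  have hg : Measurable g := by fun_prop
  set μ : Measure ℝ := (volume.restrict (Set.Ioi 0)).withDensity g with hμ
  set f : ℝ → ℝ := fun x => (x / s) ^ (-(1 / a)) with hf
  have hfm : Measurable f := by fun_prop
  have hsplit : ∀ x ∈ Set.Ioi (0 : ℝ), (g x).toReal • f x =
      s ^ (1 / a) * (Real.exp (-x) * x ^ ((1 - 1 / a) - 1)) := by
    intro x hx
    have hx : 0 < x := hx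
    simp only [g, hf, smul_eq_mul, ENNReal.toReal_ofReal (Real.exp_pos _).le]
    rw [Real.div_rpow hx.le hs.le, Real.rpow_neg hs.le]
    have : (1 - 1 / a) - 1 = -(1 / a) := by ring
    rw [this]
    field_simp
  have hconv := (Real.GammaIntegral_convergent (s := 1 - 1 / a) (by linarith)).const_mul
    (s ^ (1 / a))
  have hint : Integrable f μ := by
    rw [hμ, integrable_withDensity_iff_integrable_smul' hg (ae_of_all _ fun _ => by simp [g])]
    exact (integrableOn_congr_fun hsplit measurableSet_Ioi).2 hconv
  have hpos : 0 ≤ᵐ[μ] f := by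
    have : ∀ᵐ x ∂(volume.restrict (Set.Ioi (0 : ℝ))), 0 ≤ f x := by
      filter_upwards [ae_restrict_mem measurableSet_Ioi] with x hx
      have hx : 0 < x := hx
      positivity
    exact (withDensity_absolutelyContinuous _ _).ae_le this
  have hmean : ∫ x, f x ∂μ = s ^ (1 / a) * Real.Gamma (1 - 1 / a) := by
    rw [hμ, integral_withDensity_eq_integral_toReal_smul hg (ae_of_all _ fun _ => by simp [g]),
      setIntegral_congr_fun measurableSet_Ioi hsplit, integral_const_mul,
      Real.Gamma_eq_integral (by linarith)]
  rw [← hmean, hint.integral_eq_integral_meas_lt hpos]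
  refine setIntegral_congr_fun measurableSet_Ioi fun y hy => ?_
  have hy : 0 < y := hy
  set c := s * y ^ (-a) with hc
  have hc0 : 0 < c := by positivity
  -- The exponent `-(1 / a)` is negative, so `f` is decreasing and its superlevel sets are intervals
  -- starting at 0.
  have hset : {x | y < f x} ∩ Set.Ioi 0 = Set.Ioo 0 c := by
    ext x
    simp only [Set.mem_inter_iff, Set.mem_ofPred_eq, Set.mem_Ioi, Set.mem_Ioo, hf]
    rw [and_comm]
    refine and_congr_right fun hx => ?_
    have e : y = (y ^ (-a)) ^ (-(1 / a)) := by
      rw [← Real.rpow_mul hy.le]; field_simp; simp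
    rw [hc]
    nth_rw 1 [e]
    rw [Real.rpow_lt_rpow_iff_of_neg (by positivity) (by positivity)
      (by have := one_div_pos.2 ha0; linarith), div_lt_iff₀ hs, mul_comm]
  have hmeas : MeasurableSet {x | y < f x} := measurableSet_lt measurable_const hfm
  have : ∫ x in Set.Ioo 0 c, Real.exp (-x) = 1 - Real.exp (-c) := by
    rw [← integral_Ioc_eq_integral_Ioo, ← intervalIntegral.integral_of_le hc0.le]
    simp
  simp only [measureReal_def]
  rw [hμ, withDensity_apply _ hmeas, Measure.restrict_restrict hmeas, hset, ← this,
    integral_eq_lintegral_of_nonneg_ae (ae_of_all _ fun _ => (Real.exp_pos _).le)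
      (by fun_prop)]

/-- The dominating function for tails: 1 controls it near 0, the power near infinity. -/
theorem integrableOn_min_one_mul_rpow {C a : ℝ} (ha : 1 < a) (hC : 0 ≤ C) :
    IntegrableOn (fun y : ℝ => min 1 (C * y ^ (-a))) (Set.Ioi 0) := by
  have hm : Measurable fun y : ℝ => min 1 (C * y ^ (-a)) := by fun_prop
  rw [← Set.Ioc_union_Ioi_eq_Ioi zero_le_one]
  refine IntegrableOn.union ?_ ?_
  · refine Measure.integrableOn_of_bounded (M := 1) (by simp) hm.aestronglyMeasurable ?_
    filter_upwards [ae_restrict_mem measurableSet_Ioc] with y hy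
    have : 0 ≤ min 1 (C * y ^ (-a)) :=
      le_min zero_le_one (mul_nonneg hC (Real.rpow_nonneg hy.1.le _))
    rw [Real.norm_of_nonneg this]
    exact min_le_left _ _
  · refine Integrable.mono' ((integrableOn_Ioi_rpow_of_lt (a := -a) (by linarith)
      zero_lt_one).const_mul C) hm.aestronglyMeasurable ?_
    filter_upwards [ae_restrict_mem measurableSet_Ioi] with y hy
    have hy : (1 : ℝ) < y := hy
    have : 0 ≤ min 1 (C * y ^ (-a)) :=
      le_min zero_le_one (mul_nonneg hC (Real.rpow_nonneg (by linarith) _))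
    rw [Real.norm_of_nonneg this]
    exact min_le_right _ _

/-- A tail function with `n T(n ^ (1 / α)) → s` is at most `C u ^ (-α)`. -/
theorem exists_le_mul_rpow_neg_of_tendsto {T : ℝ → ℝ} {α s : ℝ} (hα : 0 < α) (hT : Antitone T)
    (hT1 : ∀ u, T u ≤ 1)
    (hlim : Tendsto (fun n : ℕ => (n : ℝ) * T ((n : ℝ) ^ (1 / α))) atTop (𝓝 s)) :
    ∃ C, 0 ≤ C ∧ ∀ u, 0 < u → T u ≤ C * u ^ (-α) := by
  obtain ⟨K, hK⟩ := hlim.bddAbove_range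
  have hK : ∀ n : ℕ, (n : ℝ) * T ((n : ℝ) ^ (1 / α)) ≤ K := fun n => hK ⟨n, rfl⟩
  have hK0 : 0 ≤ K := by simpa using hK 0
  refine ⟨max 1 (2 * K), by positivity, fun u hu => ?_⟩
  rcases lt_or_ge u 1 with h1 | h1
  · calc T u ≤ 1 := hT1 u
      _ ≤ u ^ (-α) := Real.one_le_rpow_of_pos_of_le_one_of_nonpos hu h1.le (by linarith)
      _ ≤ _ := le_mul_of_one_le_left (by positivity) (le_max_left _ _)
  · have h2 : 1 ≤ u ^ α := Real.one_le_rpow h1 hα.le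
    -- As `n ^ (1 / α) ≤ u`, monotonicity gives `T u ≤ K / n`; the factor 2 comes from `u ^ α < n +
    -- 1 ≤ 2 n`.
    set n := ⌊u ^ α⌋₊
    have hn1 : 1 ≤ n := Nat.one_le_floor_iff _ |>.2 h2
    have hn1' : (1 : ℝ) ≤ n := by exact_mod_cast hn1
    have hnle : (n : ℝ) ≤ u ^ α := Nat.floor_le (by positivity)
    have hnlt : u ^ α < n + 1 := Nat.lt_floor_add_one _
    have hnu : (n : ℝ) ^ (1 / α) ≤ u := by
      calc (n : ℝ) ^ (1 / α) ≤ (u ^ α) ^ (1 / α) := by gcongr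
        _ = u := by rw [← Real.rpow_mul hu.le]; field_simp; simp
    have h3 : T u ≤ K / n := by
      rw [le_div_iff₀ (by positivity), mul_comm]
      exact (mul_le_mul_of_nonneg_left (hT hnu) (by positivity)).trans (hK n)
    calc T u ≤ K / n := h3
      _ ≤ 2 * K / u ^ α := by
        rw [div_le_div_iff₀ (by positivity) (by positivity)]
        nlinarith
      _ = 2 * K * u ^ (-α) := by rw [Real.rpow_neg hu.le]; rfl
      _ ≤ _ := by gcongr; exact le_max_right _ _

/-! ### Exponential concentration and Borel–Cantelli. -/

section Concentration

variable {Ω : Type*} [MeasurableSpace Ω] {P : Measure Ω} [IsProbabilityMeasure P]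

/-- Integrate `exp x ≤ 1 + x + x ^ 2`, valid for `|x| ≤ 1`; the linear term has mean zero. -/
theorem mgf_sub_le_exp_of_integral_sq_le {X : Ω → ℝ} {L lam μ V : ℝ} (hX : Measurable X)
    (h0 : ∀ ω, 0 ≤ X ω) (hL : ∀ ω, X ω ≤ L) (hmean : ∫ ω, X ω ∂P = μ)
    (hV : ∫ ω, X ω ^ 2 ∂P ≤ V) (hlam : |lam| * L ≤ 1) :
    mgf (fun ω => X ω - μ) P lam ≤ Real.exp (lam ^ 2 * V) := by
  have hXi : Integrable X P := Integrable.of_bound hX.aestronglyMeasurable L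
    (ae_of_all _ fun ω => by rw [Real.norm_of_nonneg (h0 ω)]; exact hL ω)
  have hX2i : Integrable (fun ω => X ω ^ 2) P :=
    Integrable.of_bound (by fun_prop) (L ^ 2)
    (ae_of_all _ fun ω => by
      rw [Real.norm_of_nonneg (by positivity)]; exact pow_le_pow_left₀ (h0 ω) (hL ω) 2)
  have hμ0 : 0 ≤ μ := hmean ▸ integral_nonneg h0
  have hμL : μ ≤ L := by
    have := integral_mono hXi (integrable_const L) hL
    simpa [hmean] using this
  have hpt : ∀ ω, Real.exp (lam * (X ω - μ)) ≤
      1 + lam * (X ω - μ) + lam ^ 2 * (X ω ^ 2 - 2 * μ * X ω + μ ^ 2) := by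
    intro ω
    have h1 : |lam * (X ω - μ)| ≤ 1 := by
      rw [abs_mul]
      refine (mul_le_mul_of_nonneg_left ?_ (abs_nonneg _)).trans hlam
      rw [abs_le]; constructor <;> linarith [h0 ω, hL ω]
    have := (abs_le.1 (Real.abs_exp_sub_one_sub_id_le h1)).2
    nlinarith
  have hi : Integrable (fun ω =>
      1 + lam * (X ω - μ) + lam ^ 2 * (X ω ^ 2 - 2 * μ * X ω + μ ^ 2)) P := by fun_prop
  have hcalc : ∫ ω, (1 + lam * (X ω - μ) + lam ^ 2 * (X ω ^ 2 - 2 * μ * X ω + μ ^ 2)) ∂P =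
      1 + lam ^ 2 * (∫ ω, X ω ^ 2 ∂P - μ ^ 2) := by
    rw [integral_add (by fun_prop) (by fun_prop), integral_add (by fun_prop) (by fun_prop),
      integral_const_mul, integral_const_mul, integral_add (by fun_prop) (by fun_prop),
      integral_sub (by fun_prop) (by fun_prop), integral_sub (by fun_prop) (by fun_prop),
      integral_const_mul, hmean]
    simp only [integral_const, probReal_univ, smul_eq_mul]
    ring
  calc mgf (fun ω => X ω - μ) P lam
      ≤ ∫ ω, (1 + lam * (X ω - μ) + lam ^ 2 * (X ω ^ 2 - 2 * μ * X ω + μ ^ 2)) ∂P :=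
        integral_mono_of_nonneg (ae_of_all _ fun _ => (Real.exp_pos _).le) hi (ae_of_all _ hpt)
    _ = 1 + lam ^ 2 * (∫ ω, X ω ^ 2 ∂P - μ ^ 2) := hcalc
    _ ≤ lam ^ 2 * V + 1 := by nlinarith [sq_nonneg lam, sq_nonneg (lam * μ)]
    _ ≤ _ := Real.add_one_le_exp _

/-- A Bernstein inequality for independent variables in `[0, L]` with the same mean. -/
theorem measureReal_le_abs_sum_sub_le {n : ℕ} {X : Fin n → Ω → ℝ} {L lam μ V ε : ℝ}
    (hind : iIndepFun X P) (hX : ∀ i, Measurable (X i))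
    (h0 : ∀ i ω, 0 ≤ X i ω) (hL : ∀ i ω, X i ω ≤ L) (hmean : ∀ i, ∫ ω, X i ω ∂P = μ)
    (hV : ∀ i, ∫ ω, X i ω ^ 2 ∂P ≤ V) (hlam0 : 0 ≤ lam) (hlam : lam * L ≤ 1) :
    P.real {ω | ε ≤ |∑ i, (X i ω - μ)|} ≤ 2 * Real.exp (-lam * ε + n * (lam ^ 2 * V)) := by
  have hind' : iIndepFun (fun i ω => X i ω - μ) P :=
    hind.comp (fun _ x => x - μ) (fun _ => by fun_prop)
  have hm' : ∀ i, Measurable (fun ω => X i ω - μ) := fun i => (hX i).sub_const _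
  set S : Ω → ℝ := ∑ i, (fun ω => X i ω - μ) with hS
  have hSapp : ∀ ω, S ω = ∑ i, (X i ω - μ) := fun ω => by simp [hS]
  have hSm : Measurable S := by
    rw [show S = fun ω => ∑ i, (X i ω - μ) from funext hSapp]
    fun_prop
  have hSb : ∀ ω, |S ω| ≤ ∑ _i : Fin n, (L + |μ|) := fun ω => by
    rw [hSapp]
    refine (Finset.abs_sum_le_sum_abs _ _).trans (Finset.sum_le_sum fun i _ => ?_)
    refine (abs_sub _ _).trans ?_
    rw [abs_of_nonneg (h0 i ω)]
    linarith [hL i ω]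
  have hint : ∀ u : ℝ, Integrable (fun ω => Real.exp (u * S ω)) P := fun u => by
    refine Integrable.of_bound (by fun_prop) (Real.exp (|u| * ∑ _i : Fin n, (L + |μ|)))
      (ae_of_all _ fun ω => ?_)
    rw [Real.norm_of_nonneg (Real.exp_pos _).le, Real.exp_le_exp]
    refine (le_abs_self _).trans ?_
    rw [abs_mul]
    exact mul_le_mul_of_nonneg_left (hSb ω) (abs_nonneg _)
  have hmgf : ∀ u : ℝ, |u| = lam → mgf S P u ≤ Real.exp (n * (lam ^ 2 * V)) := fun u hu => by
    rw [hS, hind'.mgf_sum hm']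
    refine (Finset.prod_le_prod (fun i _ => mgf_nonneg) fun i _ =>
      mgf_sub_le_exp_of_integral_sq_le (hX i) (h0 i) (hL i) (hmean i) (hV i)
        (by rw [hu]; exact hlam)).trans ?_
    rw [Finset.prod_const, ← Real.exp_nat_mul, ← hu, sq_abs]
    simp
  have hone : P.real {ω | ε ≤ S ω} ≤ Real.exp (-lam * ε + n * (lam ^ 2 * V)) := by
    refine (measure_ge_le_exp_mul_mgf ε hlam0 (hint lam)).trans ?_
    rw [Real.exp_add]
    exact mul_le_mul_of_nonneg_left (hmgf lam (abs_of_nonneg hlam0)) (Real.exp_pos _).le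
  have htwo : P.real {ω | S ω ≤ -ε} ≤ Real.exp (-lam * ε + n * (lam ^ 2 * V)) := by
    refine (measure_le_le_exp_mul_mgf (-ε) (neg_nonpos.2 hlam0) (hint (-lam))).trans ?_
    rw [Real.exp_add, neg_neg, mul_neg, ← neg_mul]
    exact mul_le_mul_of_nonneg_left (hmgf (-lam) (by rw [abs_neg, abs_of_nonneg hlam0]))
      (Real.exp_pos _).le
  have hsub : {ω | ε ≤ |∑ i, (X i ω - μ)|} ⊆ {ω | ε ≤ S ω} ∪ {ω | S ω ≤ -ε} := fun ω hω => by
    simp only [Set.mem_ofPred_eq, Set.mem_union, ← hSapp] at hω ⊢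
    rcases le_abs.1 hω with h | h
    · exact Or.inl h
    · exact Or.inr (by linarith)
  calc _ ≤ P.real ({ω | ε ≤ S ω} ∪ {ω | S ω ≤ -ε}) := measureReal_mono hsub
    _ ≤ _ := measureReal_union_le _ _
    _ ≤ _ := by linarith

theorem ae_eventually_notMem_of_isBigO {s : ℕ → Set Ω} {p : ℝ} (hp : p < -1)
    (h : (fun N => P.real (s N)) =O[atTop] fun N : ℕ => (N : ℝ) ^ p) :
    ∀ᵐ ω ∂P, ∀ᶠ N in atTop, ω ∉ s N := by
  refine ae_eventually_notMem ?_
  have hsum := summable_of_isBigO_nat (Real.summable_nat_rpow.2 hp) h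
  have := hsum.tsum_ofReal_ne_top
  simpa [measureReal_def] using this

end Concentration

/-! ### Independence and tails of group maxima. -/

section Maxima

theorem setOf_finset_sup_le {Ω κ : Type*} (R : κ → Ω → NNReal) (A : Finset κ) (y : NNReal) :
    {ω | (A.sup fun j => R j ω) ≤ y} = ⋂ j ∈ A, R j ⁻¹' Set.Iic y := by
  ext ω
  simp

variable {Ω : Type*} [MeasurableSpace Ω] {P : Measure Ω}

theorem measurable_finset_sup {κ : Type*} {R : κ → Ω → NNReal} (hm : ∀ j, Measurable (R j))
    (A : Finset κ) : Measurable fun ω => A.sup fun j => R j ω := by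
  classical
  induction A using Finset.induction_on with
  | empty => simp
  | insert j A _ ih =>
    simp only [Finset.sup_insert]
    exact (hm j).sup ih

/-- Maxima of independent variables over disjoint groups are independent. -/
theorem iIndepFun_finset_sup {ι κ : Type*} {R : κ → Ω → NNReal} (hR : iIndepFun R P)
    (hm : ∀ j, Measurable (R j)) {G : ι → Finset κ} (hG : Pairwise fun i j => Disjoint (G i) (G j)) :
    iIndepFun (fun i ω => (G i).sup fun j => R j ω) P := by
  classical
  set M : ι → Ω → NNReal := fun i ω => (G i).sup fun j => R j ω
  have hM : ∀ i, Measurable (M i) := fun i => measurable_finset_sup hm (G i)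
  have hprod : ∀ (B : Finset κ) (z : κ → NNReal),
      P (⋂ j ∈ B, R j ⁻¹' Set.Iic (z j)) = ∏ j ∈ B, P (R j ⁻¹' Set.Iic (z j)) := fun B z =>
    hR.measure_inter_preimage_eq_mul B (sets := fun j => Set.Iic (z j))
      fun _ _ => measurableSet_Iic
  have hset : ∀ i y, M i ⁻¹' Set.Iic y = ⋂ j ∈ G i, R j ⁻¹' Set.Iic y := fun i y =>
    setOf_finset_sup_le R (G i) y
  rw [iIndepFun_iff_iIndep]
  refine iIndepSets.iIndep (fun i => (hM i).comap_le)
    (fun i => {s | ∃ y ∈ Set.range (Set.Iic : NNReal → Set NNReal), M i ⁻¹' y = s})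
    (fun i => isPiSystem_Iic.comap (M i)) (fun i => ?_) ?_
  · rw [BorelSpace.measurable_eq (α := NNReal), borel_eq_generateFrom_Iic,
      MeasurableSpace.comap_generateFrom]
    rfl
  · rw [iIndepSets_iff]
    intro S f hf
    have hf' : ∀ i, ∃ y, i ∈ S → f i = M i ⁻¹' Set.Iic y := fun i => by
      by_cases hi : i ∈ S
      · obtain ⟨_, ⟨y, rfl⟩, h⟩ := hf i hi
        exact ⟨y, fun _ => h.symm⟩
      · exact ⟨0, fun h => absurd h hi⟩
    choose y hy using hf'
    -- The threshold of the group containing `j`, unambiguous by disjointness. It turns the joint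
    -- event into a single intersection over indices.
    set z : κ → NNReal := fun j => if h : ∃ i, j ∈ G i then y h.choose else 0
    have hz : ∀ i, ∀ j ∈ G i, z j = y i := fun i j hj => by
      have h : ∃ i, j ∈ G i := ⟨i, hj⟩
      have : h.choose = i := by
        by_contra hne
        exact Finset.disjoint_left.1 (hG hne) h.choose_spec hj
      simp only [z, dif_pos h, this]
    have h1 : ⋂ i ∈ S, f i = ⋂ j ∈ S.biUnion G, R j ⁻¹' Set.Iic (z j) := by
      rw [Finset.set_biInter_biUnion]
      refine Set.iInter₂_congr fun i hi => ?_
      rw [hy i hi, hset]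
      exact Set.iInter₂_congr fun j hj => by rw [hz i j hj]
    rw [h1, hprod, Finset.prod_biUnion fun i _ j _ hij => hG hij]
    refine Finset.prod_congr rfl fun i hi => ?_
    rw [hy i hi, hset, ← Finset.prod_congr rfl fun j hj => by rw [hz i j hj], ← hprod]

variable [IsProbabilityMeasure P] {d : ℕ} {ξ : ℕ → Ω → EuclideanSpace ℝ (Fin d)}

theorem measurable_maxNorm (hmeas : ∀ j, Measurable (ξ j)) (A : Finset ℕ) :
    Measurable fun ω => maxNorm (fun j => ξ j ω) A :=
  (measurable_finset_sup (fun j => (hmeas j).nnnorm) A).coe_nnreal_real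

/-- The tail of the largest norm in a group of independent, identically distributed vectors. -/
theorem measureReal_lt_maxNorm (hmeas : ∀ j, Measurable (ξ j)) (hindep : iIndepFun ξ P)
    (hident : ∀ j, IdentDistrib (ξ j) (ξ 0) P P) (A : Finset ℕ) {y : ℝ} (hy : 0 ≤ y) :
    P.real {ω | y < maxNorm (fun j => ξ j ω) A} =
      1 - (1 - P.real {ω | y < ‖ξ 0 ω‖}) ^ A.card := by
  lift y to NNReal using hy
  have hR : iIndepFun (fun j ω => ‖ξ j ω‖₊) P :=
    hindep.comp (fun _ x => ‖x‖₊) fun _ => measurable_nnnorm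
  have hcompl : {ω | (y : ℝ) < maxNorm (fun j => ξ j ω) A}ᶜ =
      ⋂ j ∈ A, (fun ω => ‖ξ j ω‖₊) ⁻¹' Set.Iic y := by
    rw [← setOf_finset_sup_le]
    ext ω
    simp [maxNorm]
  have hone : ∀ j, P.real ((fun ω => ‖ξ j ω‖₊) ⁻¹' Set.Iic y) =
      1 - P.real {ω | (y : ℝ) < ‖ξ 0 ω‖} := fun j => by
    rw [← probReal_compl_eq_one_sub (measurableSet_lt measurable_const (hmeas 0).norm),
      measureReal_def, measureReal_def]
    congr 1
    have h := (hident j).measure_mem_eq (s := {x | ‖x‖₊ ≤ y})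
      (measurableSet_le measurable_nnnorm measurable_const)
    have hset : {ω | (y : ℝ) < ‖ξ 0 ω‖}ᶜ = ξ 0 ⁻¹' {x | ‖x‖₊ ≤ y} := by
      ext ω
      simp [← NNReal.coe_le_coe]
    rw [hset]
    exact h
  have hm := measurableSet_lt (measurable_const (a := (y : ℝ))) (measurable_maxNorm hmeas A)
  have hcard : P.real {ω | (y : ℝ) < maxNorm (fun j => ξ j ω) A}ᶜ =
      (1 - P.real {ω | (y : ℝ) < ‖ξ 0 ω‖}) ^ A.card := by
    rw [hcompl, measureReal_def,
      hR.measure_inter_preimage_eq_mul A (sets := fun _ => Set.Iic y)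
        fun _ _ => measurableSet_Iic, ENNReal.toReal_prod]
    exact Finset.prod_eq_pow_card fun j _ => hone j
  rw [probReal_compl_eq_one_sub hm] at hcard
  linarith

end Maxima

/-! ### Moments of truncated variables. -/

section Truncation

variable {Ω : Type*} [MeasurableSpace Ω] {P : Measure Ω} [IsProbabilityMeasure P]

/-- The right side depends on the tail alone, so all variables in a row share one truncated mean. -/
theorem integral_min_eq_integral_tail {Z : Ω → ℝ} {F : ℝ → ℝ} {L : ℝ} (hZ : Measurable Z)
    (h0 : ∀ ω, 0 ≤ Z ω) (hL : 0 ≤ L) (hF : ∀ y, 0 < y → P.real {ω | y < Z ω} = F y) :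
    ∫ ω, min (Z ω) L ∂P = ∫ y in Set.Ioi (0 : ℝ), (Set.Iio L).indicator F y := by
  have hint : Integrable (fun ω => min (Z ω) L) P :=
    Integrable.of_bound (by fun_prop) L (ae_of_all _ fun ω => by
      rw [Real.norm_of_nonneg (le_min (h0 ω) hL)]; exact min_le_right _ _)
  rw [hint.integral_eq_integral_meas_lt (ae_of_all _ fun ω => le_min (h0 ω) hL)]
  refine setIntegral_congr_fun measurableSet_Ioi fun y hy => ?_
  by_cases h : y < L
  · simp [h, ← hF y hy]
  · simp [h]

/-- The tail of `Z ^ 2` is `O(y ^ (-(a / 2)))` with `a / 2 > 1`, so the bound does not depend on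
`L`. -/
theorem integral_min_sq_le {Z : Ω → ℝ} {C a L : ℝ} (hZ : Measurable Z)
    (h0 : ∀ ω, 0 ≤ Z ω) (hL : 0 ≤ L) (ha : 2 < a) (hC : 0 ≤ C)
    (hF : ∀ y, 0 < y → P.real {ω | y < Z ω} ≤ C * y ^ (-a)) :
    ∫ ω, min (Z ω) L ^ 2 ∂P ≤ ∫ y in Set.Ioi (0 : ℝ), min 1 (C * y ^ (-(a / 2))) := by
  have hint : Integrable (fun ω => min (Z ω) L ^ 2) P :=
    Integrable.of_bound (by fun_prop) (L ^ 2) (ae_of_all _ fun ω => by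
      rw [Real.norm_of_nonneg (by positivity)]
      exact pow_le_pow_left₀ (le_min (h0 ω) hL) (min_le_right _ _) 2)
  rw [hint.integral_eq_integral_meas_lt (ae_of_all _ fun ω => by positivity)]
  refine integral_mono_of_nonneg (ae_of_all _ fun _ => measureReal_nonneg)
    (integrableOn_min_one_mul_rpow (by linarith) hC) ?_
  filter_upwards [ae_restrict_mem measurableSet_Ioi] with y hy
  have hy : 0 < y := hy
  refine le_min measureReal_le_one ?_
  have hsub : {ω | y < min (Z ω) L ^ 2} ⊆ {ω | y ^ (1 / 2 : ℝ) < Z ω} := fun ω hω => by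
    have hω : y < min (Z ω) L ^ 2 := hω
    show y ^ (1 / 2 : ℝ) < Z ω
    rw [← Real.sqrt_eq_rpow]
    exact ((Real.sqrt_lt' (lt_of_pow_lt_pow_left₀ 2 (le_min (h0 ω) hL)
      (by simpa using hy.trans hω))).2 hω).trans_le (min_le_left _ _)
  refine (measureReal_mono hsub).trans ((hF _ (by positivity)).trans_eq ?_)
  rw [← Real.rpow_mul hy.le]
  ring_nf

/-- Truncated means of variables with a common power bound on the tails converge when the
tails do. -/
theorem tendsto_integral_indicator_tail {F : ℕ → ℝ → ℝ} {F₀ : ℝ → ℝ} {L : ℕ → ℝ} {C a : ℝ}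
    (ha : 1 < a) (hC : 0 ≤ C) (hmeas : ∀ N, Measurable (F N))
    (hL : Tendsto L atTop atTop)
    (hbound : ∀ᶠ N in atTop, ∀ y, 0 < y → 0 ≤ F N y ∧ F N y ≤ 1 ∧ F N y ≤ C * y ^ (-a))
    (hlim : ∀ y, 0 < y → Tendsto (fun N => F N y) atTop (𝓝 (F₀ y))) :
    Tendsto (fun N => ∫ y in Set.Ioi (0 : ℝ), (Set.Iio (L N)).indicator (F N) y) atTop
      (𝓝 (∫ y in Set.Ioi (0 : ℝ), F₀ y)) := by
  refine tendsto_integral_filter_of_dominated_convergence (fun y => min 1 (C * y ^ (-a)))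
    (Eventually.of_forall fun N =>
      ((hmeas N).indicator measurableSet_Iio).aestronglyMeasurable) ?_
    (integrableOn_min_one_mul_rpow ha hC) ?_
  · filter_upwards [hbound] with N hN
    filter_upwards [ae_restrict_mem measurableSet_Ioi] with y hy
    obtain ⟨h0, h1, h2⟩ := hN y hy
    refine (norm_indicator_le_norm_self _ _).trans ?_
    rw [Real.norm_of_nonneg h0]
    exact le_min h1 h2
  · filter_upwards [ae_restrict_mem measurableSet_Ioi] with y hy
    refine (hlim y hy).congr' ?_
    filter_upwards [hL.eventually_gt_atTop y] with N hN
    simp [hN]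

end Truncation

/-! ### Growth of the number and size of groups. -/

section GroupAsymptotics

theorem groupCount_le (r : ℝ) (N : ℕ) : (groupCount r N : ℝ) ≤ (N : ℝ) ^ r :=
  Nat.floor_le (by positivity)

theorem half_rpow_le_groupCount {r : ℝ} (hr : 0 < r) {N : ℕ} (hN : 1 ≤ N) :
    (N : ℝ) ^ r / 2 ≤ groupCount r N := by
  have h1 : (1 : ℝ) ≤ (N : ℝ) ^ r := Real.one_le_rpow (by exact_mod_cast hN) hr.le
  have h2 : (1 : ℝ) ≤ groupCount r N := by exact_mod_cast (Nat.one_le_floor_iff _).2 h1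
  have h3 : (N : ℝ) ^ r < groupCount r N + 1 := Nat.lt_floor_add_one _
  linarith

theorem tendsto_groupSize_atTop {r : ℝ} (hr0 : 0 < r) (hr1 : r < 1) :
    Tendsto (groupSize r) atTop atTop := by
  have h1 : Tendsto (fun N : ℕ => (N : ℝ) ^ (1 - r)) atTop atTop :=
    (tendsto_rpow_atTop (by linarith)).comp tendsto_natCast_atTop_atTop
  have h2 : Tendsto (fun N : ℕ => (N : ℝ) / groupCount r N) atTop atTop := by
    refine tendsto_atTop_mono' _ ?_ h1
    filter_upwards [eventually_ge_atTop 1] with N hN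
    have hN0 : (0 : ℝ) < N := by exact_mod_cast hN
    have hn : (0 : ℝ) < groupCount r N :=
      lt_of_lt_of_le (by positivity) (half_rpow_le_groupCount hr0 hN)
    rw [Real.rpow_sub hN0, Real.rpow_one]
    exact div_le_div_of_nonneg_left hN0.le hn (groupCount_le r N)
  refine (tendsto_nat_floor_atTop.comp h2).congr fun N => ?_
  simp [groupSize, Nat.floor_div_eq_div]

end GroupAsymptotics

/-! ### The strong law for triangular arrays. -/

section TriangularArray

variable {Ω : Type*} [MeasurableSpace Ω] {P : Measure Ω} [IsProbabilityMeasure P]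

theorem isBigO_exp_neg_mul_natCast_rpow {c q : ℝ} (hc : 0 < c) (hq : 0 < q) (p : ℝ) :
    (fun N : ℕ => Real.exp (-c * (N : ℝ) ^ q)) =O[atTop] fun N : ℕ => (N : ℝ) ^ p := by
  have h := (isLittleO_exp_neg_mul_rpow_atTop hc (p / q)).isBigO.comp_tendsto
    ((tendsto_rpow_atTop hq).comp tendsto_natCast_atTop_atTop)
  refine h.congr (fun _ => rfl) fun N => ?_
  simp only [Function.comp_apply]
  rw [← Real.rpow_mul (by positivity), mul_div_cancel₀ _ hq.ne']

/-- A strong law for rows of about `N ^ r` independent nonnegative variables with a common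
tail in each row, when the tails are uniformly `O(y ^ (-a))` with `a r > 2`. -/
theorem ae_tendsto_average_of_tail {r a C : ℝ} (hr0 : 0 < r) (hr1 : r < 1) (har : 2 < a * r)
    (hC : 0 ≤ C) {n : ℕ → ℕ} (hnle : ∀ N, (n N : ℝ) ≤ (N : ℝ) ^ r)
    (hnge : ∀ᶠ N : ℕ in atTop, (N : ℝ) ^ r / 2 ≤ n N) {Y : (N : ℕ) → Fin (n N) → Ω → ℝ}
    (hY : ∀ N i, Measurable (Y N i)) (h0 : ∀ N i ω, 0 ≤ Y N i ω)
    (hind : ∀ N, iIndepFun (Y N) P) {F : ℕ → ℝ → ℝ} {F₀ : ℝ → ℝ} (hFm : ∀ N, Measurable (F N))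
    (hF : ∀ᶠ N in atTop, ∀ i y, 0 < y → P.real {ω | y < Y N i ω} = F N y)
    (hFC : ∀ᶠ N in atTop, ∀ y, 0 < y → F N y ≤ C * y ^ (-a))
    (hlim : ∀ y, 0 < y → Tendsto (fun N => F N y) atTop (𝓝 (F₀ y))) :
    ∀ᵐ ω ∂P, Tendsto (fun N => (∑ i, Y N i ω) / n N) atTop
      (𝓝 (∫ y in Set.Ioi (0 : ℝ), F₀ y)) := by
  have ha : 2 < a := by nlinarith
  -- Three constraints fix the range of `b`: `a b > 1 + r` makes the union bound summable, `b < r`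
  -- makes the Bernstein exponent grow, and `2 b ≥ r` keeps the variance term bounded.
  set b : ℝ := r * ((1 + r) / 2) with hb
  have hb0 : 0 < b := by positivity
  set L : ℕ → ℝ := fun N => (N : ℝ) ^ b with hLdef
  have hL : Tendsto L atTop atTop := (tendsto_rpow_atTop hb0).comp tendsto_natCast_atTop_atTop
  have hL0 : ∀ N, 0 ≤ L N := fun N => by positivity
  set μ : ℕ → ℝ := fun N => ∫ y in Set.Ioi (0 : ℝ), (Set.Iio (L N)).indicator (F N) y
  set V : ℝ := ∫ y in Set.Ioi (0 : ℝ), min 1 (C * y ^ (-(a / 2)))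
  have hV0 : 0 ≤ V := setIntegral_nonneg measurableSet_Ioi fun y hy =>
    le_min zero_le_one (mul_nonneg hC (Real.rpow_nonneg (le_of_lt hy) _))
  have hnpos : ∀ᶠ N in atTop, (0 : ℝ) < n N := by
    filter_upwards [hnge, eventually_ge_atTop 1] with N hN h1
    have : (0 : ℝ) < N := by exact_mod_cast h1
    exact lt_of_lt_of_le (by positivity) hN
  have hμ : Tendsto μ atTop (𝓝 (∫ y in Set.Ioi (0 : ℝ), F₀ y)) := by
    refine tendsto_integral_indicator_tail (a := a) (by linarith) hC hFm hL ?_ hlim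
    -- `F N` is known to lie in `[0, 1]` only as the tail of an actual variable, so the row must be
    -- nonempty.
    filter_upwards [hF, hFC, hnpos] with N hN hNC hn y hy
    have hi : 0 < n N := by exact_mod_cast hn
    refine ⟨?_, ?_, hNC y hy⟩
    · rw [← hN ⟨0, hi⟩ y hy]; exact measureReal_nonneg
    · rw [← hN ⟨0, hi⟩ y hy]; exact measureReal_le_one
  have hlarge : ∀ᵐ ω ∂P, ∀ᶠ N in atTop, ω ∉ ⋃ i, {ω | L N < Y N i ω} := by
    refine ae_eventually_notMem_of_isBigO (p := r - b * a) (by rw [hb]; nlinarith) ?_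
    refine Asymptotics.IsBigO.of_bound C ?_
    filter_upwards [hF, hFC, eventually_ge_atTop 1] with N hN hNC h1
    have hN0 : (0 : ℝ) < N := by exact_mod_cast h1
    have hLN : 0 < L N := by positivity
    rw [Real.norm_of_nonneg measureReal_nonneg, Real.norm_of_nonneg (by positivity)]
    calc P.real (⋃ i, {ω | L N < Y N i ω}) ≤ ∑ i, P.real {ω | L N < Y N i ω} :=
          measureReal_iUnion_fintype_le _
      _ ≤ ∑ _i : Fin (n N), C * L N ^ (-a) :=
          Finset.sum_le_sum fun i _ => (hN i _ hLN).trans_le (hNC _ hLN)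
      _ = n N * (C * L N ^ (-a)) := by simp
      _ ≤ (N : ℝ) ^ r * (C * L N ^ (-a)) := by gcongr; exact hnle N
      _ = C * (N : ℝ) ^ (r - b * a) := by
          rw [hLdef, ← Real.rpow_mul hN0.le, sub_eq_add_neg, Real.rpow_add hN0]
          ring_nf
  -- Tolerances `1 / (k + 1)` suffice, and countably many null sets can be discarded together.
  have hdev : ∀ k : ℕ, ∀ᵐ ω ∂P, ∀ᶠ N in atTop,
      ω ∉ {ω | n N * (1 / ((k : ℝ) + 1)) ≤ |∑ i, (min (Y N i ω) (L N) - μ N)|} := by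
    intro k
    set ε : ℝ := 1 / ((k : ℝ) + 1)
    have hε : 0 < ε := by positivity
    refine ae_eventually_notMem_of_isBigO (p := -2) (by norm_num) ?_
    refine Asymptotics.IsBigO.trans (Asymptotics.IsBigO.of_bound (2 * Real.exp V) ?_)
      (isBigO_exp_neg_mul_natCast_rpow (c := ε / 2) (q := r - b) (by positivity)
        (by rw [hb]; nlinarith) (-2))
    filter_upwards [hF, hFC, hnge, eventually_ge_atTop 1] with N hN hNC hge h1
    have hN1 : (1 : ℝ) ≤ N := by exact_mod_cast h1
    have hN0 : (0 : ℝ) < N := by linarith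
    have hLN : 0 < L N := by positivity
    rw [Real.norm_of_nonneg measureReal_nonneg, Real.norm_of_nonneg (Real.exp_pos _).le]
    have hindm : iIndepFun (fun i ω => min (Y N i ω) (L N)) P :=
      (hind N).comp (fun _ x => min x (L N)) fun _ => by fun_prop
    -- `lam = 1 / L` is the largest admissible choice; the exponent is then at most `-(ε / 2) N ^ (r
    -- - b) + V`.
    refine (measureReal_le_abs_sum_sub_le (lam := (L N)⁻¹) (L := L N) (V := V) hindm
      (fun i => (hY N i).min measurable_const) (fun i ω => le_min (h0 N i ω) (hL0 N))
      (fun i ω => min_le_right _ _)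
      (fun i => integral_min_eq_integral_tail (hY N i) (h0 N i) (hL0 N) (hN i))
      (fun i => integral_min_sq_le (hY N i) (h0 N i) (hL0 N) ha hC
        fun y hy => (hN i y hy).trans_le (hNC y hy))
      (by positivity) (by rw [inv_mul_cancel₀ hLN.ne'])).trans ?_
    rw [mul_assoc, ← Real.exp_add]
    refine mul_le_mul_of_nonneg_left (Real.exp_le_exp.2 ?_) two_pos.le
    have e1 : (N : ℝ) ^ (r - b) = (N : ℝ) ^ r * (L N)⁻¹ := by
      rw [Real.rpow_sub hN0]; rfl
    have e2 : (n N : ℝ) * (L N)⁻¹ ^ 2 ≤ 1 := by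
      rw [inv_pow, ← div_eq_mul_inv, div_le_one (by positivity)]
      refine (hnle N).trans ?_
      rw [hLdef, ← Real.rpow_natCast, ← Real.rpow_mul hN0.le]
      refine Real.rpow_le_rpow_of_exponent_le hN1 ?_
      rw [hb]; push_cast; nlinarith
    have e3 : n N * ((L N)⁻¹ ^ 2 * V) ≤ V := by
      rw [← mul_assoc]; exact mul_le_of_le_one_left hV0 e2
    have e4 : ε / 2 * ((N : ℝ) ^ r * (L N)⁻¹) ≤ (L N)⁻¹ * (n N * ε) := by
      have : 0 ≤ (L N)⁻¹ * ε := by positivity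
      nlinarith [mul_le_mul_of_nonneg_left hge this]
    rw [e1]
    linarith
  filter_upwards [hlarge, ae_all_iff.2 hdev] with ω hω1 hω2
  have hdiff : Tendsto (fun N => (∑ i, Y N i ω) / n N - μ N) atTop (𝓝 0) := by
    rw [Metric.tendsto_nhds]
    intro ε hε
    obtain ⟨k, hk⟩ := exists_nat_one_div_lt hε
    filter_upwards [hω1, hω2 k, hnpos] with N h1 h2 hn
    simp only [Set.mem_iUnion, Set.mem_ofPred_eq, not_exists, not_lt] at h1
    simp only [not_le] at h2
    have e : ∑ i, (min (Y N i ω) (L N) - μ N) = n N * ((∑ i, Y N i ω) / n N - μ N) := by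
      rw [Finset.sum_congr rfl fun i _ => by rw [min_eq_left (h1 i)], Finset.sum_sub_distrib,
        mul_sub, mul_div_cancel₀ _ hn.ne']
      simp
    rw [e, abs_mul, abs_of_pos hn] at h2
    rw [Real.dist_eq, sub_zero]
    exact (lt_of_mul_lt_mul_left h2 hn.le).trans hk
  simpa using hdiff.add hμ

end TriangularArray

/-! ### The radial tail and the consistency of the estimator. -/

theorem RegularVariationWith.tendsto_tail {d : ℕ} {Ω : Type*} [MeasurableSpace Ω] {P : Measure Ω}
    {X : Ω → EuclideanSpace ℝ (Fin d)} {α : ℝ} {σ : Measure (UnitSphere d)} {b : ℕ → ℝ}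
    (h : RegularVariationWith P X α σ b) (hb : ∀ n, 0 ≤ b n) {ρ : ℝ} (hρ : 0 < ρ) :
    Tendsto (fun n : ℕ => (n : ℝ) * P.real {ω | ρ * b n < ‖X ω‖}) atTop
      (𝓝 (σ.real Set.univ * ρ ^ (-α))) := by
  refine (h ρ hρ Set.univ MeasurableSet.univ (by simp)).congr fun n => ?_
  congr 2
  ext ω
  simp only [Set.image_univ, Subtype.range_coe_subtype, Set.mem_ofPred_eq, and_iff_right_iff_imp,
    mem_sphere_zero_iff_norm]
  intro hω
  have : 0 < ‖X ω‖ := lt_of_le_of_lt (mul_nonneg hρ.le (hb n)) hω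
  rw [norm_smul, norm_inv, norm_norm, inv_mul_cancel₀ this.ne']

theorem mainTheorem5 {d : ℕ} {Ω : Type*} [MeasurableSpace Ω] (P : Measure Ω)
    [IsProbabilityMeasure P] (α r t : ℝ) (hα : 0 < α) (hr0 : 0 < r) (hr1 : r < 1)
    (ht0 : 0 < t) (ht : t < α * r / 2)
    (σ : Measure (UnitSphere d)) [IsFiniteMeasure σ]
    (ξ : ℕ → Ω → EuclideanSpace ℝ (Fin d))
    (hmeas : ∀ j, Measurable (ξ j)) (hindep : iIndepFun ξ P)
    (hident : ∀ j, IdentDistrib (ξ j) (ξ 0) P P)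
    (hrv : RegularVariationWith P (ξ 0) α σ (fun n => (n : ℝ) ^ (1 / α)))
    (G : ℕ → ℕ → Finset ℕ)
    (hG : ∀ N, IsGrouping N (groupCount r N) (groupSize r N) (G N)) :
    ∀ᵐ ω ∂P, Tendsto
      (fun N : ℕ => totalMassEstimator α t (groupCount r N) (groupSize r N) (G N)
        (fun j => ξ j ω))
      atTop (𝓝 (σ.real Set.univ)) := by
  set s := σ.real Set.univ
  have hs : 0 ≤ s := measureReal_nonneg
  set T : ℝ → ℝ := fun x => P.real {ω | x < ‖ξ 0 ω‖}
  have hTanti : Antitone T := fun x y hxy => measureReal_mono fun ω hω => lt_of_le_of_lt hxy hω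
  have hT1 : ∀ u, T u ≤ 1 := fun u => measureReal_le_one
  have htail : ∀ ρ, 0 < ρ → Tendsto (fun n : ℕ => (n : ℝ) * T (ρ * (n : ℝ) ^ (1 / α))) atTop
      (𝓝 (s * ρ ^ (-α))) := fun ρ hρ => hrv.tendsto_tail (fun n => by positivity) hρ
  obtain ⟨C, hC, hTC⟩ := exists_le_mul_rpow_neg_of_tendsto (s := s) hα hTanti hT1
    (by simpa using htail 1 one_pos)
  set F : ℕ → ℝ → ℝ := fun m y => 1 - (1 - T (y ^ (1 / t) * (m : ℝ) ^ (1 / α))) ^ m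
  have hm := tendsto_groupSize_atTop hr0 hr1
  have ha1 : t / α < 1 := by rw [div_lt_one hα]; nlinarith
  have ha : 1 < α / t := by rw [lt_div_iff₀ ht0]; nlinarith
  have hmean := ae_tendsto_average_of_tail (P := P) (r := r) (a := α / t) (C := C) hr0 hr1
    (by rw [div_mul_eq_mul_div, lt_div_iff₀ ht0]; linarith) hC
    (n := groupCount r) (groupCount_le r)
    ((eventually_ge_atTop 1).mono fun N hN => half_rpow_le_groupCount hr0 hN)
    (Y := fun N i ω =>
      (maxNorm (fun j => ξ j ω) (G N i) / (groupSize r N : ℝ) ^ (1 / α)) ^ t)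
    (fun N i => ((measurable_maxNorm hmeas _).div_const _).pow_const t)
    (fun N i ω => Real.rpow_nonneg (div_nonneg NNReal.zero_le_coe (by positivity)) _)
    (fun N => by
      have h1 : iIndepFun (fun j ω => ‖ξ j ω‖₊) P :=
        hindep.comp (fun _ x => ‖x‖₊) fun _ => measurable_nnnorm
      have h2 := iIndepFun_finset_sup h1 (fun j => (hmeas j).nnnorm)
        (G := fun i : Fin (groupCount r N) => G N i) fun i j hij =>
          (hG N).disjoint i i.2 j j.2 fun h => hij (Fin.ext h)
      exact h2.comp
        (fun _ x => ((x : ℝ) / (groupSize r N : ℝ) ^ (1 / α)) ^ t) fun _ => by fun_prop)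
    (F := fun N => F (groupSize r N)) (F₀ := fun y => 1 - Real.exp (-(s * y ^ (-(α / t)))))
    (fun N => by
      have := hTanti.measurable
      fun_prop)
    (by
      filter_upwards [hm.eventually_ge_atTop 1] with N hN i y hy
      have hN : (0 : ℝ) < groupSize r N := by exact_mod_cast hN
      have hset : {ω | y < (maxNorm (fun j => ξ j ω) (G N i) /
          (groupSize r N : ℝ) ^ (1 / α)) ^ t} = {ω | y ^ (1 / t) * (groupSize r N : ℝ) ^ (1 / α) <
            maxNorm (fun j => ξ j ω) (G N i)} := by
        ext ω
        have hq : 0 ≤ maxNorm (fun j => ξ j ω) (G N i) / (groupSize r N : ℝ) ^ (1 / α) :=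
          div_nonneg NNReal.zero_le_coe (by positivity)
        simp only [Set.mem_ofPred_eq]
        rw [← lt_div_iff₀ (by positivity), one_div t, Real.rpow_inv_lt_iff_of_pos hy.le hq ht0]
      rw [hset, measureReal_lt_maxNorm hmeas hindep hident _ (by positivity),
        (hG N).card_eq i i.2])
    (by
      filter_upwards [hm.eventually_ge_atTop 1] with N hN y hy
      have hN : (0 : ℝ) < groupSize r N := by exact_mod_cast hN
      set x := y ^ (1 / t) * (groupSize r N : ℝ) ^ (1 / α)
      have hx : 0 < x := by positivity
      -- Bernoulli's inequality gives `1 - (1 - T x) ^ m ≤ m T x`; the factor `m` cancels against `x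
      -- ^ (-α)`.
      have h1 := one_add_mul_le_pow (a := -T x) (by linarith [hT1 x]) (groupSize r N)
      have h2 : x ^ (-α) = y ^ (-(α / t)) * (groupSize r N : ℝ)⁻¹ := by
        rw [Real.mul_rpow (by positivity) (by positivity), ← Real.rpow_mul hy.le,
          ← Real.rpow_mul hN.le, ← Real.rpow_neg_one]
        congr 2 <;> field_simp
      calc F (groupSize r N) y ≤ groupSize r N * T x := by
            simp only [F]
            rw [← sub_eq_add_neg] at h1
            linarith
        _ ≤ groupSize r N * (C * x ^ (-α)) := by gcongr; exact hTC x hx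
        _ = C * y ^ (-(α / t)) := by rw [h2]; field_simp)
    (fun y hy => by
      have h1 := (htail (y ^ (1 / t)) (by positivity)).neg
      have h2 : Tendsto (fun m : ℕ => (1 + -T (y ^ (1 / t) * (m : ℝ) ^ (1 / α))) ^ m) atTop
          (𝓝 (Real.exp (-(s * (y ^ (1 / t)) ^ (-α))))) :=
        Real.tendsto_one_add_pow_exp_of_tendsto (by simpa using h1)
      have h3 : (y ^ (1 / t)) ^ (-α) = y ^ (-(α / t)) := by
        rw [← Real.rpow_mul hy.le]; congr 1; field_simp
      rw [h3] at h2
      exact ((h2.const_sub 1).comp hm))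
  rw [integral_one_sub_exp_neg_mul_rpow hs ha, one_div_div] at hmean
  have hΓ : 0 < Real.Gamma (1 - t / α) := Real.Gamma_pos_of_pos (by linarith)
  filter_upwards [hmean] with ω hω
  -- The exponent is nonnegative, so the power is continuous even at 0, which covers `s = 0`.
  have h1 := (hω.div_const (Real.Gamma (1 - t / α))).rpow_const (p := α / t)
    (Or.inr (by positivity))
  rw [mul_div_cancel_right₀ _ hΓ.ne', ← Real.rpow_mul hs,
    show t / α * (α / t) = 1 by field_simp, Real.rpow_one] at h1
  refine h1.congr fun N => ?_
  rw [totalMassEstimator, Finset.sum_range, div_div, one_div_mul_eq_div]
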